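/- For $n,N\ge 0$ let $\mathrm{UConf}(n,\mathbb R^N)$ be the space of unordered configurations of $n$ distinct points in $\mathbb R^N$, and let $\Psi_n(N)$ be the space (compact-open topology) of paths $\phi(t)=(t,z(t))$, $t\in\mathbb R$, with $z:\mathbb R\to \mathrm{UConf}(n,\mathbb R^N)$ continuous; the image of $\phi$ is the set $\{(t,x)\in\mathbb R\times\mathbb R^N : x\in z(t)\}$. For $R\in\mathbb N$ let $\Phi_N(R)$ be the quotient space of $\bigsqcup_{n\ge 0}\Psi_n(N)$ obtained by identifying two paths whose images have the same intersection with the cube $[-\tfrac R2,\tfrac R2]\times[-\tfrac R2,\tfrac R2]^N$, and let $\Phi_N^N=\lim_{R\in\mathbb N}\Phi_N(R)$ along the restriction maps, with the limit topology, based at the empty path $\emptyset$. A spectrum is a sequence of pointed spaces $X_N$, $N\ge 0$, with pointed continuous maps $X_N\to\Omega X_{N+1}$, where $\Omega$ is formed with $S^1=\mathbb R\cup\{\infty\}$ based at $\infty$; a map of spectra is a sequence of pointed continuous maps commuting with the structure maps. The sphere spectrum $\mathbb S$ has $\mathbb S_N=S^N=\mathbb R^N\cup\{\infty\}$ and structure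 maps adjoint to the canonical identification $S^N\wedge S^1\cong S^{N+1}$. Lemma. For $N\ge 0$ and $\phi\in\Phi_N^N$ let $\omega_N(\phi)$ be the loop that sends $t\in\mathbb R$ to $\phi+(0,\dots,0,t)$, that is, to $\phi$ placed at height $t$ in the last coordinate of $\mathbb R^{N+1}=\mathbb R^N\times\mathbb R$, and sends $\infty$ to $\emptyset$. Then the maps $\omega_N$ are well-defined pointed continuous maps $\Phi_N^N\to\Omega\Phi_{N+1}^{N+1}$, so that the spaces $\Phi_N^N$ form a spectrum $\Phi$. This spectrum is equivalent to the sphere spectrum: there are a spectrum $\Phi'$ and maps of spectra $\Phi\leftarrow\Phi'\to\mathbb S$ that are weak homotopy equivalences in every degree. -/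

import Mathlib

open Topology OnePoint

noncomputable section

/-! ### Weak homotopy equivalences -/

section WeakEquivalence

variable {X Y : Type*} [TopologicalSpace X] [TopologicalSpace Y]

/-- The map `π₀(X) → π₀(Y)` induced by a continuous map on sets of path components. -/
def pathComponentsMap (f : C(X, Y)) : ZerothHomotopy X → ZerothHomotopy Y :=
  Quotient.map f fun _ _ h => h.map f.continuous

/-- Postcomposition of an `n`-dimensional generalized loop with a continuous map. -/
def genLoopMap (f : C(X, Y)) (n : ℕ) (x : X) (γ : GenLoop (Fin n) X x) :
    GenLoop (Fin n) Y (f x) :=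
  ⟨f.comp γ.1, fun y hy => congrArg f (γ.2 y hy)⟩

/-- The map `π_n(X, x) → π_n(Y, f x)` induced by a continuous map. -/
def homotopyGroupMap (f : C(X, Y)) (n : ℕ) (x : X) :
    HomotopyGroup (Fin n) X x → HomotopyGroup (Fin n) Y (f x) :=
  Quotient.map (genLoopMap f n x) fun _ _ h => h.map fun H => H.compContinuousMap f

/-- A continuous map is a weak homotopy equivalence if it induces a bijection on path components
and, for every basepoint, bijections on all higher homotopy groups. -/
def IsWeakHomotopyEquiv (f : C(X, Y)) : Prop :=
  Function.Bijective (pathComponentsMap f) ∧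
    ∀ (n : ℕ) (x : X), Function.Bijective (homotopyGroupMap f (n + 1) x)

end WeakEquivalence

/-! ### Spectra -/

/-- The based loop space `Ω X`, where the circle is the one-point compactification of `ℝ`, based
at `∞`; it carries the compact-open topology. -/
abbrev BasedLoops (X : Type*) [TopologicalSpace X] (x : X) : Type _ :=
  {γ : C(OnePoint ℝ, X) // γ ∞ = x}

/-- A spectrum (in the sequential, not necessarily `Ω`-, sense): pointed spaces `X_n` with pointed
continuous structure maps `X_n → Ω X_{n+1}`. -/
structure Spectrum where
  space : ℕ → Type
  [topology : ∀ n, TopologicalSpace (space n)]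
  point : ∀ n, space n
  struct : ∀ n, C(space n, BasedLoops (space (n + 1)) (point (n + 1)))
  struct_point : ∀ n t, (struct n (point n)).1 t = point (n + 1)

attribute [instance] Spectrum.topology

/-- A map of spectra: pointed continuous maps `X_n → Y_n` that commute strictly with the
structure maps. -/
structure SpectrumMap (X Y : Spectrum) where
  map : ∀ n, C(X.space n, Y.space n)
  map_point : ∀ n, map n (X.point n) = Y.point n
  map_struct : ∀ n (x : X.space n) (t : OnePoint ℝ),
    map (n + 1) ((X.struct n x).1 t) = (Y.struct n (map n x)).1 t

/-- A map of spectra is a levelwise weak equivalence if it is a weak homotopy equivalence in every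
degree. -/
def SpectrumMap.IsLevelwiseWeakEquiv {X Y : Spectrum} (f : SpectrumMap X Y) : Prop :=
  ∀ n, IsWeakHomotopyEquiv (f.map n)

/-! ### The sphere spectrum -/

/-- The identification `ℝ^N × ℝ → ℝ^{N+1}` that adds a last coordinate. -/
def addCoord {N : ℕ} (x : Fin N → ℝ) (t : ℝ) : Fin (N + 1) → ℝ :=
  Fin.snoc (α := fun _ => ℝ) x t

lemma continuous_addCoord {N : ℕ} :
    Continuous fun p : (Fin N → ℝ) × ℝ => addCoord p.1 p.2 :=
  Continuous.finSnoc continuous_fst continuous_snd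

lemma addCoord_injective {N : ℕ} (t : ℝ) :
    Function.Injective fun x : Fin N → ℝ => addCoord x t := by
  intro x y h
  have := congrArg (Fin.init (α := fun _ => ℝ)) h
  simpa [addCoord] using this

/-- The sphere `S^N`, as the one-point compactification of `ℝ^N`, based at `∞`. -/
abbrev SphereSpace (N : ℕ) : Type := OnePoint (Fin N → ℝ)

/-- The canonical map `S^N × S^1 → S^N ∧ S^1 = S^{N+1}`: `(x, t) ↦ (x, t)` on
`ℝ^N × ℝ = ℝ^{N+1}`, everything else goes to `∞`. -/
def sphereSmash {N : ℕ} : SphereSpace N → OnePoint ℝ → SphereSpace (N + 1)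
  | OnePoint.some x, OnePoint.some t => OnePoint.some (addCoord x t)
  | OnePoint.some _, ∞ => ∞
  | ∞, _ => ∞

lemma continuous_sphereSmash (N : ℕ) :
    Continuous fun p : SphereSpace N × OnePoint ℝ => sphereSmash p.1 p.2 := by
  have key : ∀ V : Set (Fin (N + 1) → ℝ),
      (fun p : SphereSpace N × OnePoint ℝ => sphereSmash p.1 p.2) ⁻¹' ((↑) '' V) =
        (Prod.map (↑) (↑)) '' {p : (Fin N → ℝ) × ℝ | addCoord p.1 p.2 ∈ V} := by
    intro V
    ext ⟨x, t⟩
    induction x using OnePoint.rec <;> induction t using OnePoint.rec <;>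
      simp [sphereSmash]
  refine continuous_def.2 fun U hU => ?_
  by_cases h : ∞ ∈ U
  · obtain ⟨hc, hk⟩ := (OnePoint.isOpen_iff_of_mem h).1 hU
    rw [← isClosed_compl_iff, ← Set.preimage_compl]
    have hUc : Uᶜ = (↑) '' ((↑) ⁻¹' U : Set (Fin (N + 1) → ℝ))ᶜ := by
      ext y
      induction y using OnePoint.rec <;> simp [h]
    rw [hUc, key]
    refine IsCompact.isClosed (IsCompact.image ?_
      (OnePoint.continuous_coe.prodMap OnePoint.continuous_coe))
    have : {p : (Fin N → ℝ) × ℝ | addCoord p.1 p.2 ∈ ((↑) ⁻¹' U : Set (Fin (N + 1) → ℝ))ᶜ} =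
        (fun y : Fin (N + 1) → ℝ => ((fun i => y i.castSucc : Fin N → ℝ), y (Fin.last N))) ''
          ((↑) ⁻¹' U : Set (Fin (N + 1) → ℝ))ᶜ := by
      ext p
      constructor
      · intro hp
        exact ⟨addCoord p.1 p.2, hp, by simp [addCoord]⟩
      · rintro ⟨y, hy, rfl⟩
        have : addCoord (fun i => y i.castSucc : Fin N → ℝ) (y (Fin.last N)) = y :=
          Fin.snoc_init_self (α := fun _ => ℝ) y
        simpa [this] using hy
    rw [this]
    exact hk.image (by fun_prop)
  · have hUc : U = (↑) '' ((↑) ⁻¹' U : Set (Fin (N + 1) → ℝ)) := by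
      ext y
      induction y using OnePoint.rec <;> simp [h]
    rw [hUc, key]
    refine (OnePoint.isOpenMap_coe.prodMap OnePoint.isOpenMap_coe) _ ?_
    exact ((OnePoint.isOpen_iff_of_notMem h).1 hU).preimage continuous_addCoord

/-- The sphere spectrum: `S^N` is the one-point compactification of `ℝ^N`, and the structure map
`S^N → Ω S^{N+1}` is adjoint to the canonical map `S^N ∧ S^1 → S^{N+1}`. -/
def sphereSpectrum : Spectrum where
  space := SphereSpace
  point _ := ∞
  struct N :=
    { toFun := fun x =>
        ⟨(ContinuousMap.mk _ (continuous_sphereSmash N)).curry x, by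
          induction x using OnePoint.rec <;> rfl⟩
      continuous_toFun :=
        Continuous.subtype_mk
          ((ContinuousMap.mk _ (continuous_sphereSmash N)).curry).continuous fun x => by
            induction x using OnePoint.rec <;> rfl }
  struct_point _ _ := rfl

/-! ### Configurations and the spaces of local images -/

/-- The ordered configuration space of `n` points in `X`. -/
abbrev Conf (n : ℕ) (X : Type*) : Type _ := {x : Fin n → X // Function.Injective x}

/-- Two ordered configurations are identified when they differ by a permutation of the indices. -/
instance confSetoid (n : ℕ) (X : Type*) : Setoid (Conf n X) where
  r x y := ∃ σ : Equiv.Perm (Fin n), y.1 = x.1 ∘ σ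
  iseqv :=
    { refl := fun _ => ⟨1, rfl⟩
      symm := by
        rintro x y ⟨σ, h⟩
        exact ⟨σ⁻¹, by rw [h]; ext i; simp⟩
      trans := by
        rintro x y z ⟨σ, h⟩ ⟨τ, h'⟩
        exact ⟨σ * τ, by rw [h', h]; rfl⟩ }

/-- The unordered configuration space of `n` points in `X`, with the quotient topology. -/
def UConf (n : ℕ) (X : Type*) : Type _ := Quotient (confSetoid n X)

instance (n : ℕ) (X : Type*) [TopologicalSpace X] : TopologicalSpace (UConf n X) :=
  inferInstanceAs (TopologicalSpace (Quotient (confSetoid n X)))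

namespace UConf

/-- The set of points of an unordered configuration. -/
def points {n : ℕ} {X : Type*} : UConf n X → Set X :=
  Quotient.lift (fun x : Conf n X => Set.range x.1) (by
    rintro x y ⟨σ, h⟩
    rw [h, σ.surjective.range_comp])

/-- The image of a configuration under an injective map. -/
def map {n : ℕ} {X Y : Type*} (f : X → Y) (hf : Function.Injective f) : UConf n X → UConf n Y :=
  Quotient.map (fun x : Conf n X => (⟨f ∘ x.1, hf.comp x.2⟩ : Conf n Y)) (by
    rintro x y ⟨σ, h⟩
    exact ⟨σ, by simp only [h]; rfl⟩)

lemma points_map {n : ℕ} {X Y : Type*} (f : X → Y) (hf : Function.Injective f) (c : UConf n X) :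
    (map f hf c).points = f '' c.points := by
  induction c using Quotient.inductionOn with
  | h x => exact Set.range_comp f x.1

lemma continuous_map {n : ℕ} {X Y : Type*} [TopologicalSpace X] [TopologicalSpace Y]
    {f : X → Y} (hf : Function.Injective f) (hc : Continuous f) :
    Continuous (map (n := n) f hf) := by
  refine Continuous.quotient_map' (s := confSetoid n X) (t := confSetoid n Y) ?_ _
  exact Continuous.subtype_mk
    (continuous_pi fun i => hc.comp ((continuous_apply i).comp continuous_subtype_val)) _

/-- The configuration without points. -/
def empty (X : Type*) : UConf 0 X :=
  Quotient.mk (confSetoid 0 X) ⟨Fin.elim0, fun i => i.elim0⟩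

lemma points_empty (X : Type*) : (empty X).points = ∅ :=
  Set.range_eq_empty _

end UConf

/-- The space of paths `t ↦ (t, z(t))`, `t ∈ ℝ`, of configurations of `n` points in `ℝ^N`; such a
path is given by the continuous map `z : ℝ → UConf n ℝ^N`. Compact-open topology. -/
abbrev ConfPath (N n : ℕ) : Type := C(ℝ, UConf n (Fin N → ℝ))

/-- The disjoint union, over all numbers `n` of points, of the spaces of paths of configurations of
`n` points in `ℝ^N`. -/
abbrev ConfPaths (N : ℕ) : Type := Σ n : ℕ, ConfPath N n

namespace ConfPaths

/-- The image of a path of configurations, as a subset of `ℝ × ℝ^N` (time first). -/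
def image {N : ℕ} (φ : ConfPaths N) : Set (ℝ × (Fin N → ℝ)) :=
  {p | p.2 ∈ (φ.2 p.1).points}

/-- The path of empty configurations. -/
def empty (N : ℕ) : ConfPaths N :=
  ⟨0, ContinuousMap.const ℝ (UConf.empty (Fin N → ℝ))⟩

/-- The path of configurations in `ℝ^{N+1}` obtained from a path of configurations in `ℝ^N` by
placing it at height `t` in the last coordinate. -/
def atHeight {N : ℕ} (t : ℝ) (φ : ConfPaths N) : ConfPaths (N + 1) :=
  ⟨φ.1, (ContinuousMap.mk (UConf.map (fun x => addCoord x t) (addCoord_injective t))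
    (UConf.continuous_map _ (continuous_addCoord.comp
      (continuous_id.prodMk continuous_const)))).comp φ.2⟩

lemma image_atHeight {N : ℕ} (t : ℝ) (φ : ConfPaths N) :
    (atHeight t φ).image = (fun p => (p.1, addCoord p.2 t)) '' φ.image := by
  ext ⟨s, y⟩
  change y ∈ (UConf.map _ (addCoord_injective t) (φ.2 s)).points ↔ _
  rw [UConf.points_map]
  constructor
  · rintro ⟨x, hx, rfl⟩
    exact ⟨(s, x), hx, rfl⟩
  · rintro ⟨⟨s', x⟩, hx, h⟩
    obtain ⟨rfl, rfl⟩ := Prod.mk.inj h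
    exact ⟨x, hx, rfl⟩

end ConfPaths

/-- The cube `[-R/2, R/2] × [-R/2, R/2]^N` in `ℝ × ℝ^N`. -/
def window (N : ℕ) (R : ℕ) : Set (ℝ × (Fin N → ℝ)) :=
  {p | |p.1| ≤ R / 2 ∧ ∀ i, |p.2 i| ≤ R / 2}

lemma window_mono (N : ℕ) {R S : ℕ} (h : R ≤ S) : window N R ⊆ window N S := by
  have h' : (R : ℝ) / 2 ≤ S / 2 := by
    have : (R : ℝ) ≤ S := by exact_mod_cast h
    linarith
  exact fun p hp => ⟨hp.1.trans h', fun i => (hp.2 i).trans h'⟩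

/-- Two paths of configurations are identified when they agree in the cube of side `R`. -/
def windowSetoid (N R : ℕ) : Setoid (ConfPaths N) where
  r φ ψ := φ.image ∩ window N R = ψ.image ∩ window N R
  iseqv := ⟨fun _ => rfl, fun h => h.symm, fun h h' => h.trans h'⟩

/-- Paths of configurations in `ℝ^N`, as seen in the cube of side `R`; quotient topology. -/
def WindowImages (N R : ℕ) : Type := Quotient (windowSetoid N R)

namespace WindowImages

instance (N R : ℕ) : TopologicalSpace (WindowImages N R) :=
  inferInstanceAs (TopologicalSpace (Quotient (windowSetoid N R)))

/-- The class of a path of configurations. -/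
def mk {N : ℕ} (R : ℕ) (φ : ConfPaths N) : WindowImages N R := Quotient.mk (windowSetoid N R) φ

/-- Restriction from a cube to a smaller one. -/
def restrict {N R S : ℕ} (h : R ≤ S) : WindowImages N S → WindowImages N R :=
  Quotient.map (sa := windowSetoid N S) (sb := windowSetoid N R) id (by
    intro φ ψ hφψ
    change φ.image ∩ window N R = ψ.image ∩ window N R
    have e : φ.image ∩ window N S = ψ.image ∩ window N S := hφψ
    rw [← Set.inter_eq_self_of_subset_right (window_mono N h), ← Set.inter_assoc,
      ← Set.inter_assoc, e])

/-- Placing the path at height `t` in a new last coordinate, on classes. -/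
def atHeight {N R : ℕ} (t : ℝ) : WindowImages N R → WindowImages (N + 1) R :=
  Quotient.map (sa := windowSetoid N R) (sb := windowSetoid (N + 1) R) (ConfPaths.atHeight t) (by
    have aux : ∀ φ ψ : ConfPaths N, φ.image ∩ window N R = ψ.image ∩ window N R →
        (ConfPaths.atHeight t φ).image ∩ window (N + 1) R ⊆ (ConfPaths.atHeight t ψ).image := by
      intro φ ψ e
      simp only [ConfPaths.image_atHeight]
      rintro _ ⟨⟨p, hp, rfl⟩, hw⟩
      have hpw : p ∈ window N R :=
        ⟨hw.1, fun i => by simpa [addCoord] using hw.2 i.castSucc⟩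
      have : p ∈ ψ.image ∩ window N R := e ▸ ⟨hp, hpw⟩
      exact ⟨p, this.1, rfl⟩
    intro φ ψ e
    exact Set.Subset.antisymm
      (Set.subset_inter (aux φ ψ e) Set.inter_subset_right)
      (Set.subset_inter (aux ψ φ (Eq.symm e)) Set.inter_subset_right))

end WindowImages

/-- The space `Φ_N^N` of local images: the limit over `R ∈ ℕ`, along the restriction maps, of the
spaces of paths of configurations in `ℝ^N` as seen in the cube of side `R`. -/
abbrev LocalImages (N : ℕ) : Type :=
  {φ : ∀ R : ℕ, WindowImages N R // ∀ (R S : ℕ) (h : R ≤ S),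
    WindowImages.restrict h (φ S) = φ R}

namespace LocalImages

/-- The basepoint (point at infinity) of `Φ_N^N`: the empty path. -/
def empty (N : ℕ) : LocalImages N :=
  ⟨fun R => WindowImages.mk R (ConfPaths.empty N), fun _ _ _ => rfl⟩

/-- The element `φ + (0, …, 0, t)` of `Φ_{N+1}^{N+1}`: the path `φ` placed at height `t` in the
last coordinate of `ℝ^{N+1} = ℝ^N × ℝ`. -/
def atHeight {N : ℕ} (t : ℝ) (φ : LocalImages N) : LocalImages (N + 1) :=
  ⟨fun R => WindowImages.atHeight t (φ.1 R), by
    intro R S h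
    change WindowImages.restrict h (WindowImages.atHeight t (φ.1 S)) =
      WindowImages.atHeight t (φ.1 R)
    rw [← φ.2 R S h]
    induction φ.1 S using Quotient.inductionOn with
    | h ψ => rfl⟩

/-- The loop `t ↦ φ + (0, …, 0, t)`, which takes the value the empty path at `t = ∞`. -/
def loop {N : ℕ} (φ : LocalImages N) : OnePoint ℝ → LocalImages (N + 1)
  | OnePoint.some t => atHeight t φ
  | ∞ => empty (N + 1)

end LocalImages

end

/-!
The map `sphereToLocal : S^N → Φ_N^N`, which sends `x ∈ ℝ^N` to the constant path at the single
point `x` and `∞` to the empty path, commutes with the structure maps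
(`sphereToLocal_sphereSmash`). So the sphere spectrum itself serves as the intermediate spectrum
`Φ'`, and it has to be shown that `sphereToLocal` is a weak homotopy equivalence. It is in fact the
inclusion of a strong deformation retract (`localHomotopy`); since that homotopy fixes the sphere,
basepoints are preserved (`isWeakHomotopyEquiv_of_homotopicRel`).

The deformation slows a path down until it is constant, and at the same time magnifies its
configurations by the inverse of the contraction `shrink b`, `y ↦ y / (1 + b ‖y‖)`, of `ℝ^N` onto
the ball of radius `1 / b`. Points outside that ball disappear at infinity. The final value of `b`
is the number `crowding P`, the reciprocal of the infimum of `max ‖x‖ ‖y‖` over all pairs of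
distinct points `x`, `y` of the configuration `P` at time zero: the ball of radius `1 / b` then
contains at most one point of `P`, so that the deformation ends in the sphere
(`LocalImages.exists_sphereToLocal_eq_zoom`), while `b = 0` on the sphere, which therefore does not
move.

Continuity has to be checked against the quotient and limit topologies. As `shrink b` maps each cube
into itself, magnification acts on the classes of paths seen in a fixed cube. There it is induced by
a continuous family of embeddings `expand k b` of all of `ℝ^N`, and it is jointly continuous because
the product of a quotient map with a locally compact space is a quotient map. A function of the
configuration at time zero that only depends on a bounded region is continuous if it is so on finite
configurations (`LocalImages.continuous_of_slice`). The crowding is of this kind up to an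
arbitrarily small error (`max_crowding_inter`), and the functions `closeness y` are of this kind and
separate the points of the sphere, so that the compact space `S^N` is embedded and the retraction
onto it is continuous.
-/

open scoped NNReal ENNReal unitInterval

/-! ### Strong deformation retracts are weak homotopy equivalences -/

/-- The inclusion of a strong deformation retract is a weak homotopy equivalence. As the homotopy
is constant on the image of `f`, no change of basepoint enters. -/
lemma isWeakHomotopyEquiv_of_homotopicRel {X Y : Type*} [TopologicalSpace X] [TopologicalSpace Y]
    (f : C(X, Y)) (r : C(Y, X)) (hr : ∀ x, r (f x) = x)
    (h : (ContinuousMap.id Y).HomotopicRel (f.comp r) (Set.range f)) : IsWeakHomotopyEquiv f := by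
  obtain ⟨H⟩ := h
  refine ⟨⟨?_, ?_⟩, fun n x => ⟨?_, ?_⟩⟩
  · intro a b
    induction a using Quotient.inductionOn with | h a => ?_
    induction b using Quotient.inductionOn with | h b => ?_
    intro hab
    have hj : Joined (f a) (f b) := Quotient.exact hab
    have hj' := hj.map r.continuous
    rw [hr, hr] at hj'
    exact Quotient.sound hj'
  · intro y
    induction y using Quotient.inductionOn with | h y => ?_
    refine ⟨Quotient.mk _ (r y), Quotient.sound (Joined.symm ?_)⟩
    exact ⟨H.toHomotopy.evalAt y⟩
  · intro a b
    induction a using Quotient.inductionOn with | h a => ?_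
    induction b using Quotient.inductionOn with | h b => ?_
    intro hab
    have hj : (f.comp a.1).HomotopicRel (f.comp b.1) (Cube.boundary (Fin (n + 1))) :=
      Quotient.exact hab
    have hj' := hj.comp_continuousMap r
    have e : ∀ c : C(Fin (n + 1) → I, X), r.comp (f.comp c) = c := fun c => by ext; simp [hr]
    rw [e, e] at hj'
    exact Quotient.sound hj'
  · intro d
    induction d using Quotient.inductionOn with | h d => ?_
    refine ⟨Quotient.mk _ ⟨r.comp d.1, fun y hy => ?_⟩, Quotient.sound ?_⟩
    · have : d.1 y = f x := d.2 y hy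
      simp [this, hr]
    · refine ContinuousMap.HomotopicRel.symm
        (f := (ContinuousMap.id Y).comp d.1) (g := (f.comp r).comp d.1)
        ⟨⟨H.toHomotopy.compContinuousMap d.1, fun t y hy => ?_⟩⟩
      exact H.eq_fst t ⟨x, (d.2 y hy).symm⟩

/-! ### Rescaling a normed space -/

section Rescaling

variable {V : Type*} [NormedAddCommGroup V] [NormedSpace ℝ V]

/-- The radial map that contracts `V` onto the open ball of radius `1 / b` (onto `V` if `b = 0`). -/
noncomputable def shrink (b : ℝ≥0) (y : V) : V := (1 + b * ‖y‖)⁻¹ • y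

/-- A radial embedding of `V` into itself which inverts `shrink b` as far as the values of norm at
most `k` are concerned; unlike the inverse of `shrink b` it is defined everywhere. -/
noncomputable def expand (k b : ℝ≥0) (x : V) : V :=
  (max (1 - b * ‖x‖) (1 + b * k : ℝ)⁻¹)⁻¹ • x

lemma shrink_zero (y : V) : shrink 0 y = y := by simp [shrink]

lemma norm_shrink (b : ℝ≥0) (y : V) : ‖shrink b y‖ = (1 + b * ‖y‖)⁻¹ * ‖y‖ := by
  rw [shrink, norm_smul, Real.norm_of_nonneg (by positivity)]

lemma norm_shrink_le (b : ℝ≥0) (y : V) : ‖shrink b y‖ ≤ ‖y‖ := by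
  rw [norm_shrink]
  refine mul_le_of_le_one_left (norm_nonneg y) (inv_le_one_of_one_le₀ ?_)
  have : 0 ≤ b * ‖y‖ := by positivity
  linarith

lemma mul_norm_shrink_lt_one (b : ℝ≥0) (y : V) : b * ‖shrink b y‖ < 1 := by
  have h : 0 ≤ b * ‖y‖ := by positivity
  rw [norm_shrink, mul_left_comm, inv_mul_lt_iff₀ (by linarith)]
  linarith

lemma one_sub_mul_norm_shrink (b : ℝ≥0) (y : V) :
    1 - b * ‖shrink b y‖ = (1 + b * ‖y‖)⁻¹ := by
  have h : 0 ≤ b * ‖y‖ := by positivity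
  rw [norm_shrink]
  field_simp
  ring

lemma shrink_injective (b : ℝ≥0) : Function.Injective (shrink b : V → V) := by
  refine Function.LeftInverse.injective (g := fun x => (1 - b * ‖x‖)⁻¹ • x) fun y => ?_
  have h : 0 < 1 + b * ‖y‖ := by positivity
  simp only [one_sub_mul_norm_shrink]
  rw [shrink, smul_smul, inv_inv, mul_inv_cancel₀ h.ne', one_smul]

lemma expand_shrink {k b : ℝ≥0} {y : V} (hy : ‖y‖ ≤ k) : expand k b (shrink b y) = y := by
  have h : 0 < 1 + b * ‖y‖ := by positivity
  have hle : (1 + b * k : ℝ)⁻¹ ≤ (1 + b * ‖y‖)⁻¹ := by gcongr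
  rw [expand, one_sub_mul_norm_shrink, max_eq_left hle, inv_inv, shrink, smul_smul,
    mul_inv_cancel₀ h.ne', one_smul]

/-- `expand k b` has a left inverse on all of `V`, which agrees with `shrink b` on vectors of
norm at most `k`. -/
lemma truncatedShrink_expand (k b : ℝ≥0) (x : V) :
    (1 + b * min ‖expand k b x‖ k)⁻¹ • expand k b x = x := by
  set m : ℝ := (1 + b * k)⁻¹ with hm
  have hk : (0 : ℝ) < 1 + b * k := by positivity
  have hm0 : 0 < m := by positivity
  have hmk : m * (1 + b * k) = 1 := inv_mul_cancel₀ hk.ne'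
  set μ := max (1 - b * ‖x‖) m with hμ
  have hμ0 : 0 < μ := lt_max_of_lt_right hm0
  have hn : ‖expand k b x‖ = μ⁻¹ * ‖x‖ := by
    rw [expand, norm_smul, Real.norm_of_nonneg (by positivity)]
  have key : 1 + b * min ‖expand k b x‖ k = μ⁻¹ := by
    rw [hn, mul_min_of_nonneg _ _ b.coe_nonneg]
    rcases le_total m (1 - b * ‖x‖) with h | h
    · have hμ' : μ = 1 - b * ‖x‖ := max_eq_left h
      rw [min_eq_left]
      · field_simp
        linarith
      · rw [mul_left_comm, inv_mul_le_iff₀ hμ0]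
        have : m * (b * k) ≤ μ * (b * k) := by
          gcongr
          exact le_max_right _ _
        linarith
    · have hμ' : μ = m := max_eq_right h
      rw [min_eq_right]
      · rw [hμ', hm, inv_inv]
      · rw [mul_left_comm, le_inv_mul_iff₀ hμ0, hμ']
        linarith
  rw [key, inv_inv, expand, smul_smul, mul_inv_cancel₀ hμ0.ne', one_smul]

lemma expand_injective (k b : ℝ≥0) : Function.Injective (expand k b : V → V) :=
  Function.LeftInverse.injective (g := fun y => (1 + b * min ‖y‖ k : ℝ)⁻¹ • y)
    (truncatedShrink_expand k b)

lemma eq_expand_iff {k b : ℝ≥0} {x y : V} (hy : ‖y‖ ≤ k) : expand k b x = y ↔ x = shrink b y := by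
  refine ⟨?_, fun h => h ▸ expand_shrink hy⟩
  rintro rfl
  have := truncatedShrink_expand k b x
  rwa [min_eq_left hy, eq_comm] at this

lemma continuous_expand (k : ℝ≥0) : Continuous fun p : ℝ≥0 × V => expand k p.1 p.2 := by
  unfold expand
  have h1 : Continuous fun p : ℝ≥0 × V => (1 + p.1 * k : ℝ)⁻¹ :=
    Continuous.inv₀ (by fun_prop) fun p => by positivity
  refine Continuous.smul (Continuous.inv₀ (by fun_prop) fun p => ?_) continuous_snd
  have : (0 : ℝ) < (1 + p.1 * k : ℝ)⁻¹ := by positivity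
  exact (lt_max_of_lt_right this).ne'

end Rescaling

/-! ### Local images as subsets -/

section Support

variable {N : ℕ}

lemma mem_window_iff {R : ℕ} {p : ℝ × (Fin N → ℝ)} :
    p ∈ window N R ↔ |p.1| ≤ (R : ℝ) / 2 ∧ ‖p.2‖ ≤ ((R / 2 : ℝ≥0) : ℝ) := by
  rw [pi_norm_le_iff_of_nonneg (by positivity)]
  simp [window]

lemma exists_mem_window (p : ℝ × (Fin N → ℝ)) : ∃ R, p ∈ window N R := by
  obtain ⟨R, hR⟩ := exists_nat_ge (2 * max |p.1| ‖p.2‖)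
  have h1 := le_max_left |p.1| ‖p.2‖
  have h2 := le_max_right |p.1| ‖p.2‖
  refine ⟨R, mem_window_iff.2 ⟨by linarith, ?_⟩⟩
  push_cast
  linarith

/-- The part of the image of a path that is visible in the cube. -/
def WindowImages.trace {R : ℕ} : WindowImages N R → Set (ℝ × (Fin N → ℝ)) :=
  Quotient.lift (fun φ => φ.image ∩ window N R) fun _ _ h => h

lemma WindowImages.trace_injective {R : ℕ} :
    Function.Injective (WindowImages.trace : WindowImages N R → _) := by
  intro v w
  induction v using Quotient.inductionOn with | h φ => ?_
  induction w using Quotient.inductionOn with | h ψ => ?_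
  exact fun h => Quotient.sound h

lemma WindowImages.exists_mk {R : ℕ} (w : WindowImages N R) : ∃ φ, WindowImages.mk R φ = w :=
  Quotient.exists_rep w

lemma WindowImages.trace_restrict {R S : ℕ} (h : R ≤ S) (w : WindowImages N S) :
    (w.restrict h).trace = w.trace ∩ window N R := by
  obtain ⟨φ, rfl⟩ := w.exists_mk
  change φ.image ∩ window N R = φ.image ∩ window N S ∩ window N R
  rw [Set.inter_assoc, Set.inter_eq_self_of_subset_right (window_mono N h)]

lemma WindowImages.continuous_mk (R : ℕ) : Continuous (WindowImages.mk R : ConfPaths N → _) :=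
  continuous_quotient_mk'

lemma WindowImages.isQuotientMap_mk (R : ℕ) :
    IsQuotientMap (WindowImages.mk R : ConfPaths N → _) :=
  isQuotientMap_quotient_mk'

/-- The subset of `ℝ × ℝ^N` described by a local image: the union of its traces in all cubes. -/
def LocalImages.support (φ : LocalImages N) : Set (ℝ × (Fin N → ℝ)) :=
  ⋃ R, (φ.1 R).trace

/-- The traces are recovered from their union, because they are compatible with restriction. -/
lemma LocalImages.trace_eq (φ : LocalImages N) (R : ℕ) :
    (φ.1 R).trace = φ.support ∩ window N R := by
  have hsub : ∀ S, (φ.1 S).trace ⊆ window N S := fun S => by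
    obtain ⟨ψ, h⟩ := (φ.1 S).exists_mk
    rw [← h]
    exact Set.inter_subset_right
  refine Set.Subset.antisymm
    (Set.subset_inter (Set.subset_iUnion_of_subset R subset_rfl) (hsub R)) ?_
  rintro p ⟨hp, hR⟩
  obtain ⟨S, hS⟩ := Set.mem_iUnion.1 hp
  have h1 := φ.2 R (max R S) (le_max_left R S)
  have h2 := φ.2 S (max R S) (le_max_right R S)
  rw [← h2, WindowImages.trace_restrict] at hS
  rw [← h1, WindowImages.trace_restrict]
  exact ⟨hS.1, hR⟩

lemma LocalImages.support_injective :
    Function.Injective (LocalImages.support : LocalImages N → _) := by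
  intro φ ψ h
  refine Subtype.ext (funext fun R => WindowImages.trace_injective ?_)
  rw [φ.trace_eq, ψ.trace_eq, h]

/-- The local image of a path of configurations. -/
def ConfPaths.toLocal (φ : ConfPaths N) : LocalImages N :=
  ⟨fun R => WindowImages.mk R φ, fun _ _ _ => rfl⟩

lemma ConfPaths.support_toLocal (φ : ConfPaths N) : φ.toLocal.support = φ.image := by
  ext p
  refine ⟨fun h => ?_, fun h => ?_⟩
  · obtain ⟨R, hR⟩ := Set.mem_iUnion.1 h
    exact hR.1
  · obtain ⟨R, hR⟩ := exists_mem_window p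
    exact Set.mem_iUnion.2 ⟨R, h, hR⟩

end Support

/-! ### Continuity of the structure maps -/

section Loop

variable {N : ℕ}

lemma ConfPaths.continuous_prod {P Z : Type*} [TopologicalSpace P] [TopologicalSpace Z]
    {g : ConfPaths N × P → Z}
    (hg : ∀ n, Continuous fun q : ConfPath N n × P => g (⟨n, q.1⟩, q.2)) : Continuous g := by
  rw [(Homeomorph.sigmaProdDistrib (X := ConfPath N) (Y := P)).symm.isQuotientMap.continuous_iff]
  exact continuous_sigma hg

lemma UConf.isQuotientMap_mk (n : ℕ) (X : Type*) [TopologicalSpace X] :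
    IsQuotientMap (Quotient.mk (confSetoid n X) : Conf n X → UConf n X) :=
  isQuotientMap_quotient_mk'

/-- Joint continuity: the product of the quotient map onto `UConf n X` with the identity of the
locally compact space `P` is again a quotient map. -/
lemma UConf.continuous_map_prod {P X Y : Type*} [TopologicalSpace P] [LocallyCompactSpace P]
    [TopologicalSpace X] [TopologicalSpace Y] {n : ℕ} {f : P → X → Y}
    (hf : ∀ p, Function.Injective (f p)) (hc : Continuous fun q : P × X => f q.1 q.2) :
    Continuous fun q : UConf n X × P => UConf.map (f q.2) (hf q.2) q.1 := by
  refine (UConf.isQuotientMap_mk n X).continuous_lift_prod_left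
    (g := fun q : UConf n X × P => UConf.map (f q.2) (hf q.2) q.1) ?_
  change Continuous fun q : Conf n X × P =>
    Quotient.mk (confSetoid n Y) ⟨f q.2 ∘ q.1.1, (hf q.2).comp q.1.2⟩
  refine (UConf.isQuotientMap_mk n Y).continuous.comp
    (Continuous.subtype_mk (continuous_pi fun i => ?_) fun q : Conf n X × P => (hf q.2).comp q.1.2)
  exact hc.comp (continuous_snd.prodMk ((continuous_apply i).comp
    (continuous_subtype_val.comp continuous_fst)))

lemma ConfPaths.continuous_atHeight :
    Continuous fun q : ConfPaths N × ℝ => ConfPaths.atHeight q.2 q.1 := by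
  refine ConfPaths.continuous_prod (g := fun q : ConfPaths N × ℝ => q.1.atHeight q.2) fun n => ?_
  let F : ConfPath N n × ℝ → ConfPath (N + 1) n := fun q =>
    (ConfPaths.atHeight q.2 (⟨n, q.1⟩ : ConfPaths N)).2
  suffices hF : Continuous F from continuous_sigmaMk.comp hF
  refine ContinuousMap.continuous_of_continuous_uncurry F ?_
  have h := UConf.continuous_map_prod (n := n) (f := fun (t : ℝ) (x : Fin N → ℝ) => addCoord x t)
    addCoord_injective (continuous_addCoord.comp continuous_swap)
  exact h.comp (f := fun q : (ConfPath N n × ℝ) × ℝ => (q.1.1 q.2, q.1.2)) (by fun_prop)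

lemma WindowImages.continuous_atHeight (R : ℕ) :
    Continuous fun q : WindowImages N R × ℝ => WindowImages.atHeight q.2 q.1 :=
  (WindowImages.isQuotientMap_mk R).continuous_lift_prod_left
    ((WindowImages.continuous_mk R).comp ConfPaths.continuous_atHeight)

/-- Outside the cube of side `R`, the height `t` makes every path invisible. -/
lemma WindowImages.atHeight_eq_empty {R : ℕ} {t : ℝ} (ht : (R : ℝ) / 2 < |t|)
    (w : WindowImages N R) :
    WindowImages.atHeight t w = WindowImages.mk R (ConfPaths.empty (N + 1)) := by
  obtain ⟨φ, rfl⟩ := w.exists_mk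
  refine WindowImages.trace_injective ?_
  change (ConfPaths.atHeight t φ).image ∩ _ = (ConfPaths.empty (N + 1)).image ∩ _
  rw [ConfPaths.image_atHeight]
  ext p
  constructor
  · rintro ⟨⟨q, -, rfl⟩, hw⟩
    have := hw.2 (Fin.last N)
    simp only [addCoord, Fin.snoc_last] at this
    linarith
  · rintro ⟨h, -⟩
    change p.2 ∈ (UConf.empty _).points at h
    simp [UConf.points_empty] at h

lemma setOf_lt_norm_mem_nhds_infty {V : Type*} [NormedAddCommGroup V] [ProperSpace V] (r : ℝ) :
    {t : OnePoint V | ∀ x : V, t = x → r < ‖x‖} ∈ 𝓝 (∞ : OnePoint V) := by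
  rw [OnePoint.nhds_infty_eq, Filter.mem_sup, Filter.coclosedCompact_eq_cocompact]
  refine ⟨?_, fun x hx => absurd hx (OnePoint.infty_ne_coe x)⟩
  rw [Filter.mem_map]
  refine Filter.mem_of_superset (isCompact_closedBall (0 : V) r).compl_mem_cocompact
    fun x hx y hy => ?_
  obtain rfl : x = y := OnePoint.coe_injective hy
  simpa using hx

/-- Joint continuity of `φ` and `t`; near `t = ∞`, only the empty path is visible in a given
cube. -/
lemma LocalImages.continuous_loop :
    Continuous fun q : LocalImages N × OnePoint ℝ => q.1.loop q.2 := by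
  refine Continuous.subtype_mk (continuous_pi fun R => ?_) _
  rw [continuous_iff_continuousAt]
  rintro ⟨φ, t⟩
  induction t using OnePoint.rec with
  | infty =>
    have hU := setOf_lt_norm_mem_nhds_infty (V := ℝ) ((R : ℝ) / 2)
    refine Filter.Tendsto.congr' (f₁ := fun _ => WindowImages.mk R (ConfPaths.empty (N + 1)))
      ?_ tendsto_const_nhds
    filter_upwards [continuous_snd.continuousAt.preimage_mem_nhds hU] with ⟨ψ, t⟩ ht
    induction t using OnePoint.rec with
    | infty => rfl
    | coe s => exact (WindowImages.atHeight_eq_empty (ht s rfl) (ψ.1 R)).symm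
  | coe t =>
    have e : IsOpenEmbedding (Prod.map id (↑) : LocalImages N × ℝ → LocalImages N × OnePoint ℝ) :=
      IsOpenEmbedding.id.prodMap OnePoint.isOpenEmbedding_coe
    refine (e.continuousAt_iff (x := (φ, t))).1 (Continuous.continuousAt ?_)
    exact (WindowImages.continuous_atHeight R).comp
      (Continuous.prodMap ((continuous_apply R).comp continuous_subtype_val) continuous_id)

end Loop

/-! ### Zooming in -/

section Zoom

variable {N : ℕ}

/-- Slows a path down by the factor `c` and applies `expand k b` to its configurations. -/
noncomputable def ConfPaths.zoom (k : ℝ≥0) (c : I) (b : ℝ≥0) (φ : ConfPaths N) : ConfPaths N :=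
  ⟨φ.1, ⟨fun t => UConf.map (expand k b) (expand_injective k b) (φ.2 (c * t)),
    (UConf.continuous_map _ ((continuous_expand k).comp
      (continuous_const.prodMk continuous_id))).comp
      (φ.2.continuous.comp (continuous_const.mul continuous_id))⟩⟩

lemma ConfPaths.mem_image_zoom {k : ℝ≥0} {c : I} {b : ℝ≥0} {φ : ConfPaths N}
    {p : ℝ × (Fin N → ℝ)} (hp : ‖p.2‖ ≤ k) :
    p ∈ (φ.zoom k c b).image ↔ ((c : ℝ) * p.1, shrink b p.2) ∈ φ.image := by
  suffices h : p.2 ∈ (UConf.map _ (expand_injective k b) (φ.2 ((c : ℝ) * p.1))).points ↔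
    shrink b p.2 ∈ (φ.2 ((c : ℝ) * p.1)).points from h
  rw [UConf.points_map]
  constructor
  · rintro ⟨x, hx, h⟩
    rwa [← (eq_expand_iff hp).1 h]
  · exact fun h => ⟨_, h, expand_shrink hp⟩

lemma ConfPaths.continuous_zoom (k : ℝ≥0) :
    Continuous fun q : ConfPaths N × (I × ℝ≥0) => q.1.zoom k q.2.1 q.2.2 := by
  refine ConfPaths.continuous_prod
    (g := fun q : ConfPaths N × (I × ℝ≥0) => q.1.zoom k q.2.1 q.2.2) fun n => ?_
  let F : ConfPath N n × (I × ℝ≥0) → ConfPath N n := fun q =>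
    (ConfPaths.zoom k q.2.1 q.2.2 (⟨n, q.1⟩ : ConfPaths N)).2
  suffices hF : Continuous F from continuous_sigmaMk.comp hF
  refine ContinuousMap.continuous_of_continuous_uncurry F ?_
  have h := UConf.continuous_map_prod (n := n) (f := fun (b : ℝ≥0) (x : Fin N → ℝ) => expand k b x)
    (expand_injective k) (continuous_expand k)
  exact h.comp (f := fun q : (ConfPath N n × (I × ℝ≥0)) × ℝ =>
    (q.1.1 ((q.1.2.1 : ℝ) * q.2), q.1.2.2)) (by fun_prop)

lemma shrink_mem_window {R : ℕ} {p : ℝ × (Fin N → ℝ)} (hp : p ∈ window N R) (c : I) (b : ℝ≥0) :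
    ((c : ℝ) * p.1, shrink b p.2) ∈ window N R := by
  rw [mem_window_iff] at hp ⊢
  refine ⟨?_, (norm_shrink_le b p.2).trans hp.2⟩
  rw [abs_mul, abs_of_nonneg c.2.1]
  exact (mul_le_of_le_one_left (abs_nonneg _) c.2.2).trans hp.1

lemma ConfPaths.image_zoom_inter_window (R : ℕ) (c : I) (b : ℝ≥0) (φ : ConfPaths N) :
    (φ.zoom (R / 2) c b).image ∩ window N R =
      {p | ((c : ℝ) * p.1, shrink b p.2) ∈ φ.image ∩ window N R} ∩ window N R := by
  ext p
  refine and_congr_left fun hp => ?_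
  rw [ConfPaths.mem_image_zoom (mem_window_iff.1 hp).2]
  exact ⟨fun h => ⟨h, shrink_mem_window hp c b⟩, fun h => h.1⟩

/-- Zooming in, as seen in a cube: as `shrink b` maps the cube into itself, what is visible after
zooming in depends only on what was visible before. -/
noncomputable def WindowImages.zoom {R : ℕ} (c : I) (b : ℝ≥0) :
    WindowImages N R → WindowImages N R :=
  Quotient.map (sa := windowSetoid N R) (sb := windowSetoid N R) (ConfPaths.zoom (R / 2) c b) (by
    intro φ ψ h
    change _ ∩ _ = _ ∩ _
    change _ ∩ _ = _ ∩ _ at h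
    rw [ConfPaths.image_zoom_inter_window, ConfPaths.image_zoom_inter_window, h])

lemma WindowImages.trace_zoom {R : ℕ} (c : I) (b : ℝ≥0) (w : WindowImages N R) :
    (w.zoom c b).trace = {p | ((c : ℝ) * p.1, shrink b p.2) ∈ w.trace} ∩ window N R := by
  obtain ⟨φ, rfl⟩ := w.exists_mk
  exact ConfPaths.image_zoom_inter_window R c b φ

lemma WindowImages.continuous_zoom (R : ℕ) :
    Continuous fun q : WindowImages N R × (I × ℝ≥0) => q.1.zoom q.2.1 q.2.2 :=
  (WindowImages.isQuotientMap_mk R).continuous_lift_prod_left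
    ((WindowImages.continuous_mk R).comp (ConfPaths.continuous_zoom _))

/-- Zooming in: time is slowed down by the factor `c`, and the open ball of radius `1 / b` is
spread over `ℝ^N` by the inverse of `shrink b`, all points outside the ball being discarded. -/
noncomputable def LocalImages.zoom (c : I) (b : ℝ≥0) (φ : LocalImages N) : LocalImages N :=
  ⟨fun R => (φ.1 R).zoom c b, by
    intro R S h
    refine WindowImages.trace_injective ?_
    rw [WindowImages.trace_restrict, WindowImages.trace_zoom, WindowImages.trace_zoom,
      ← φ.2 R S h, WindowImages.trace_restrict, Set.inter_assoc,
      Set.inter_eq_self_of_subset_right (window_mono N h)]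
    ext p
    exact and_congr_left fun hp => ⟨fun h => ⟨h, shrink_mem_window hp c b⟩, fun h => h.1⟩⟩

lemma LocalImages.support_zoom (c : I) (b : ℝ≥0) (φ : LocalImages N) :
    (φ.zoom c b).support = {p | ((c : ℝ) * p.1, shrink b p.2) ∈ φ.support} := by
  ext p
  obtain ⟨R, hR⟩ := exists_mem_window p
  have h1 : p ∈ (φ.zoom c b).support ↔ p ∈ ((φ.zoom c b).1 R).trace := by
    rw [LocalImages.trace_eq]
    exact ⟨fun h => ⟨h, hR⟩, fun h => h.1⟩
  rw [h1]
  change p ∈ ((φ.1 R).zoom c b).trace ↔ _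
  rw [WindowImages.trace_zoom, φ.trace_eq]
  exact ⟨fun h => h.1.1, fun h => ⟨⟨h, shrink_mem_window hR c b⟩, hR⟩⟩

lemma LocalImages.continuous_zoom :
    Continuous fun q : LocalImages N × (I × ℝ≥0) => q.1.zoom q.2.1 q.2.2 := by
  refine Continuous.subtype_mk (continuous_pi fun R => ?_) _
  exact (WindowImages.continuous_zoom R).comp
    (Continuous.prodMap ((continuous_apply R).comp continuous_subtype_val) continuous_id)

end Zoom

/-! ### Continuous functions on the space of local images -/

section Slice

variable {N : ℕ}

/-- The points of a local image at time zero. -/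
def LocalImages.slice (φ : LocalImages N) : Set (Fin N → ℝ) := {x | (0, x) ∈ φ.support}

lemma ConfPaths.slice_toLocal (φ : ConfPaths N) : φ.toLocal.slice = (φ.2 0).points := by
  ext x
  change (0, x) ∈ φ.toLocal.support ↔ _
  rw [ConfPaths.support_toLocal]
  rfl

/-- The points of the cube at which a path is seen at time zero. -/
def WindowImages.slice {R : ℕ} (w : WindowImages N R) : Set (Fin N → ℝ) := {x | (0, x) ∈ w.trace}

lemma LocalImages.slice_eq (φ : LocalImages N) (R : ℕ) :
    (φ.1 R).slice = φ.slice ∩ {x | ‖x‖ ≤ (R / 2 : ℝ≥0)} := by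
  ext x
  change (0, x) ∈ (φ.1 R).trace ↔ _
  rw [φ.trace_eq, Set.mem_inter_iff, mem_window_iff]
  refine and_congr Iff.rfl ?_
  simp only [abs_zero, Set.mem_ofPred_eq, and_iff_right_iff_imp]
  intro
  positivity

/-- In a bounded region, a local image at time zero looks like a finite configuration. -/
lemma LocalImages.exists_range_inter_eq (φ : LocalImages N) (R : ℕ) :
    ∃ (n : ℕ) (x : Conf n (Fin N → ℝ)), φ.slice ∩ {x | ‖x‖ ≤ (R / 2 : ℝ≥0)} =
      Set.range x.1 ∩ {x | ‖x‖ ≤ (R / 2 : ℝ≥0)} := by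
  obtain ⟨ψ, h⟩ := (φ.1 R).exists_mk
  obtain ⟨x, hx⟩ := Quotient.exists_rep (ψ.2 0)
  refine ⟨ψ.1, x, ?_⟩
  rw [← φ.slice_eq, ← h]
  change (ψ.toLocal.1 R).slice = _
  rw [ψ.toLocal.slice_eq, ψ.slice_toLocal, ← hx]
  rfl

/-- A function of the configuration at time zero that depends continuously on finite
configurations, and only on the points in a bounded region, is continuous on `Φ_N^N`. -/
lemma LocalImages.continuous_of_slice {Z : Type*} [TopologicalSpace Z] (g : Set (Fin N → ℝ) → Z)
    (R : ℕ) (hR : ∀ P, g (P ∩ {x | ‖x‖ ≤ (R / 2 : ℝ≥0)}) = g P)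
    (hg : ∀ n, Continuous fun x : Conf n (Fin N → ℝ) => g (Set.range x.1)) :
    Continuous fun φ : LocalImages N => g φ.slice := by
  have key : Continuous fun w : WindowImages N R => g w.slice := by
    refine (WindowImages.isQuotientMap_mk R).continuous_iff.2 (continuous_sigma fun n => ?_)
    have e : ∀ φ : ConfPaths N, g (WindowImages.mk R φ).slice = g (φ.2 0).points := fun φ => by
      rw [← ConfPaths.slice_toLocal, ← hR φ.toLocal.slice, ← LocalImages.slice_eq]
      rfl
    simp only [Function.comp_def, e]
    have hu : Continuous fun c : UConf n (Fin N → ℝ) => g c.points :=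
      (UConf.isQuotientMap_mk n _).continuous_iff.2 (hg n)
    exact hu.comp (continuous_eval_const (F := ConfPath N n) 0)
  have e : ∀ φ : LocalImages N, g φ.slice = g (φ.1 R).slice := fun φ => by
    rw [φ.slice_eq, hR]
  simp only [e]
  exact key.comp ((continuous_apply R).comp continuous_subtype_val)

lemma continuous_iSup_of_finite {ι X : Type*} [Finite ι] [TopologicalSpace X] {f : ι → X → ℝ≥0∞}
    (hf : ∀ i, Continuous (f i)) : Continuous fun x => ⨆ i, f i x := by
  cases nonempty_fintype ι
  simp only [← Finset.sup_univ_eq_iSup]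
  exact Continuous.finset_sup_apply (s := Finset.univ) fun i _ => hf i

/-- How closely a set comes within distance `1` of the point `y`. -/
noncomputable def closeness (y : Fin N → ℝ) (P : Set (Fin N → ℝ)) : ℝ≥0∞ := ⨆ x ∈ P, 1 - edist x y

lemma LocalImages.continuous_closeness (y : Fin N → ℝ) :
    Continuous fun φ : LocalImages N => closeness y φ.slice := by
  obtain ⟨R, hR⟩ := exists_nat_ge (2 * (‖y‖ + 1))
  refine LocalImages.continuous_of_slice (closeness y) R (fun P => ?_) fun n => ?_
  · refine le_antisymm (biSup_mono Set.inter_subset_left) (iSup₂_le fun x hx => ?_)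
    by_cases h : ‖x‖ ≤ (R / 2 : ℝ≥0)
    · exact le_iSup₂_of_le x ⟨hx, h⟩ le_rfl
    · rw [tsub_eq_zero_of_le]
      · exact zero_le
      · push_cast at h
        have := norm_sub_norm_le x y
        rw [edist_dist, ENNReal.one_le_ofReal, dist_eq_norm]
        linarith
  · simp only [closeness, iSup_range]
    refine continuous_iSup_of_finite fun i => ?_
    refine ENNReal.continuous_sub_left ENNReal.one_ne_top |>.comp ?_
    exact ((continuous_apply i).comp continuous_subtype_val).edist continuous_const

/-- The reciprocal of the infimum of `max ‖x‖ ‖y‖` over all pairs of distinct points `x`, `y` of a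
set: it is `0` if the set has at most one point, and the open ball of radius `1 / crowding P`
contains at most one point of `P`. -/
noncomputable def crowding (P : Set (Fin N → ℝ)) : ℝ≥0∞ :=
  ⨆ x ∈ P, ⨆ y ∈ P, ⨆ _ : x ≠ y, (max ‖x‖ₑ ‖y‖ₑ)⁻¹

lemma le_crowding {P : Set (Fin N → ℝ)} {x y : Fin N → ℝ} (hx : x ∈ P) (hy : y ∈ P) (h : x ≠ y) :
    (max ‖x‖ₑ ‖y‖ₑ)⁻¹ ≤ crowding P :=
  le_iSup₂_of_le x hx (le_iSup₂_of_le y hy (le_iSup_of_le h le_rfl))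

lemma crowding_eq_zero {P : Set (Fin N → ℝ)} (h : P.Subsingleton) : crowding P = 0 := by
  refine le_antisymm (iSup₂_le fun x hx => iSup₂_le fun y hy => iSup_le fun hxy => ?_) zero_le
  exact absurd (h hx hy) hxy

lemma crowding_range {n : ℕ} (x : Conf n (Fin N → ℝ)) :
    crowding (Set.range x.1) = ⨆ i, ⨆ j, ⨆ _ : i ≠ j, (max ‖x.1 i‖ₑ ‖x.1 j‖ₑ)⁻¹ := by
  simp only [crowding, iSup_range, x.2.ne_iff]

lemma continuous_crowding_range (n : ℕ) :
    Continuous fun x : Conf n (Fin N → ℝ) => crowding (Set.range x.1) := by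
  simp only [crowding_range]
  have h : ∀ i, Continuous fun x : Conf n (Fin N → ℝ) => ‖x.1 i‖ₑ := fun i =>
    ((continuous_apply i).comp continuous_subtype_val).enorm
  refine continuous_iSup_of_finite fun i => continuous_iSup_of_finite fun j => ?_
  by_cases hij : i = j
  · simpa [hij] using continuous_const
  · simp only [ne_eq, hij, not_false_eq_true, iSup_pos]
    exact ((h i).max (h j)).inv

lemma crowding_range_lt_top {n : ℕ} (x : Conf n (Fin N → ℝ)) : crowding (Set.range x.1) < ⊤ := by
  rw [crowding_range]
  simp only [← Finset.sup_univ_eq_iSup, Finset.sup_lt_iff ENNReal.zero_lt_top]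
  refine fun i _ j _ => ?_
  by_cases h : i = j
  · simp [h]
  · simp only [ne_eq, h, not_false_eq_true, iSup_pos, ENNReal.inv_lt_top, lt_max_iff, enorm_pos]
    by_contra! h'
    exact h (x.2 (h'.1.trans h'.2.symm))

/-- Pairs of points with a member of norm greater than `k` contribute at most `1 / k` to the
crowding. -/
lemma max_crowding_inter (k : ℝ≥0) (P : Set (Fin N → ℝ)) :
    max (crowding (P ∩ {x | ‖x‖ ≤ k})) (k : ℝ≥0∞)⁻¹ = max (crowding P) (k : ℝ≥0∞)⁻¹ := by
  refine le_antisymm (max_le_max_right _ ?_) (max_le ?_ (le_max_right _ _))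
  · exact iSup₂_le fun x hx => iSup₂_le fun y hy => iSup_le fun h => le_crowding hx.1 hy.1 h
  · refine iSup₂_le fun x hx => iSup₂_le fun y hy => iSup_le fun h => ?_
    have hk : ∀ z : Fin N → ℝ, ¬‖z‖ ≤ k → (k : ℝ≥0∞) ≤ ‖z‖ₑ := fun z hz => by
      rw [enorm_eq_nnnorm, ENNReal.coe_le_coe]
      exact (not_le.1 hz).le
    by_cases h1 : ‖x‖ ≤ k
    · by_cases h2 : ‖y‖ ≤ k
      · exact le_max_of_le_left (le_crowding ⟨hx, h1⟩ ⟨hy, h2⟩ h)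
      · exact le_max_of_le_right (ENNReal.inv_le_inv.2 (le_max_of_le_right (hk y h2)))
    · exact le_max_of_le_right (ENNReal.inv_le_inv.2 (le_max_of_le_left (hk x h1)))

/-- Although the slice may be infinite, only finitely many of its points are close to the origin,
and the other ones contribute little to the crowding. -/
lemma LocalImages.crowding_lt_top (φ : LocalImages N) : crowding φ.slice < ⊤ := by
  obtain ⟨n, x, hx⟩ := φ.exists_range_inter_eq 1
  refine (le_max_left _ (((1 : ℕ) / 2 : ℝ≥0) : ℝ≥0∞)⁻¹).trans_lt ?_
  rw [← max_crowding_inter, hx, max_crowding_inter]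
  exact max_lt (crowding_range_lt_top x) (by simp)

/-- A function to `[0, ∞]` is continuous if its truncations from below at arbitrarily small
levels are. -/
lemma continuous_of_continuous_max {X : Type*} [TopologicalSpace X] {f : X → ℝ≥0∞} {c : ℕ → ℝ≥0∞}
    (hc : ∀ a, 0 < a → ∃ R, c R < a) (hf : ∀ R, Continuous fun x => max (f x) (c R)) :
    Continuous f := by
  refine OrderTopology.continuous_iff.2 fun a => ⟨isOpen_iff_mem_nhds.2 fun x hx => ?_,
    isOpen_iff_mem_nhds.2 fun x hx => ?_⟩
  · obtain ⟨R, hR⟩ := hc (f x) (pos_of_gt hx)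
    have hx' : max a (c R) < max (f x) (c R) := lt_max_of_lt_left (max_lt hx hR)
    filter_upwards [(hf R).continuousAt.eventually (lt_mem_nhds hx')] with y hy
    by_contra h
    exact hy.not_ge (max_le_max_right _ (not_lt.1 h))
  · obtain ⟨R, hR⟩ := hc a (pos_of_gt hx)
    have hx' : max (f x) (c R) < a := max_lt hx hR
    filter_upwards [(hf R).continuousAt.eventually (gt_mem_nhds hx')] with y hy
    exact (le_max_left _ _).trans_lt hy

lemma LocalImages.continuous_crowding :
    Continuous fun φ : LocalImages N => (crowding φ.slice).toNNReal := by
  have h : Continuous fun φ : LocalImages N => crowding φ.slice := by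
    refine continuous_of_continuous_max (c := fun R : ℕ => ((R / 2 : ℝ≥0) : ℝ≥0∞)⁻¹)
      (fun a ha => ?_) fun R => ?_
    · obtain ⟨R, hR⟩ := ENNReal.exists_nat_gt (ENNReal.inv_ne_top.2 ha.ne')
      refine ⟨2 * R, ENNReal.inv_lt_iff_inv_lt.2 (hR.trans_le ?_)⟩
      simp
    · exact LocalImages.continuous_of_slice (fun P => max (crowding P) _) R
        (max_crowding_inter _) fun n => (continuous_crowding_range n).max continuous_const
  exact continuous_iff_continuousAt.2 fun φ =>
    (ENNReal.tendsto_toNNReal φ.crowding_lt_top.ne).comp h.continuousAt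

end Slice

/-! ### The sphere inside the space of local images -/

section Sphere

variable {N : ℕ}

/-- The configuration with the single point `x`. -/
def UConf.single {X : Type*} (x : X) : UConf 1 X :=
  Quotient.mk (confSetoid 1 X) ⟨fun _ => x, Function.injective_of_subsingleton _⟩

lemma UConf.points_single {X : Type*} (x : X) : (UConf.single x).points = {x} :=
  Set.range_const

lemma UConf.continuous_single {X : Type*} [TopologicalSpace X] :
    Continuous (UConf.single : X → UConf 1 X) :=
  (UConf.isQuotientMap_mk 1 X).continuous.comp
    (Continuous.subtype_mk (continuous_pi fun _ => continuous_id) _)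

/-- The constant path at the configuration with the single point `x`. -/
def ConfPaths.single (x : Fin N → ℝ) : ConfPaths N := ⟨1, ContinuousMap.const ℝ (UConf.single x)⟩

lemma ConfPaths.image_single (x : Fin N → ℝ) : (ConfPaths.single x).image = {p | p.2 = x} := by
  ext p
  change p.2 ∈ (UConf.single x).points ↔ _
  rw [UConf.points_single]
  rfl

lemma ConfPaths.continuous_single : Continuous (ConfPaths.single : (Fin N → ℝ) → ConfPaths N) :=
  continuous_sigmaMk.comp (ContinuousMap.continuous_const'.comp UConf.continuous_single)

lemma ConfPaths.image_empty : (ConfPaths.empty N).image = ∅ := by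
  refine Set.eq_empty_of_forall_notMem fun p hp => ?_
  change p.2 ∈ (UConf.empty _).points at hp
  simp [UConf.points_empty] at hp

/-- The map `S^N → Φ_N^N` that sends `x ∈ ℝ^N` to the constant path at `x`, and `∞` to the empty
path. -/
def sphereToLocal : SphereSpace N → LocalImages N
  | OnePoint.some x => (ConfPaths.single x).toLocal
  | ∞ => LocalImages.empty N

lemma support_sphereToLocal_coe (x : Fin N → ℝ) :
    (sphereToLocal (x : SphereSpace N)).support = {p | p.2 = x} :=
  ((ConfPaths.single x).support_toLocal).trans (ConfPaths.image_single x)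

lemma support_sphereToLocal_infty : (sphereToLocal (∞ : SphereSpace N)).support = ∅ :=
  ((ConfPaths.empty N).support_toLocal).trans ConfPaths.image_empty

lemma slice_sphereToLocal_coe (x : Fin N → ℝ) :
    (sphereToLocal (x : SphereSpace N)).slice = {x} := by
  rw [LocalImages.slice, support_sphereToLocal_coe]
  rfl

lemma slice_sphereToLocal_infty : (sphereToLocal (∞ : SphereSpace N)).slice = ∅ := by
  rw [LocalImages.slice, support_sphereToLocal_infty]
  rfl

lemma continuous_sphereToLocal : Continuous (sphereToLocal : SphereSpace N → LocalImages N) := by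
  refine Continuous.subtype_mk (continuous_pi fun R => ?_) _
  rw [continuous_iff_continuousAt]
  intro x
  induction x using OnePoint.rec with
  | infty =>
    refine Filter.Tendsto.congr' (f₁ := fun _ => WindowImages.mk R (ConfPaths.empty N))
      ?_ tendsto_const_nhds
    filter_upwards [setOf_lt_norm_mem_nhds_infty (V := Fin N → ℝ) (R / 2 : ℝ≥0)] with x hx
    induction x using OnePoint.rec with
    | infty => rfl
    | coe x =>
      refine WindowImages.trace_injective ?_
      change _ ∩ _ = (ConfPaths.single x).image ∩ _
      rw [ConfPaths.image_empty, ConfPaths.image_single, Set.empty_inter, eq_comm]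
      refine Set.eq_empty_of_forall_notMem fun p hp => ?_
      obtain rfl : p.2 = x := hp.1
      exact (mem_window_iff.1 hp.2).2.not_gt (hx _ rfl)
  | coe x =>
    refine (OnePoint.isOpenEmbedding_coe.continuousAt_iff (x := x)).1 (Continuous.continuousAt ?_)
    exact (WindowImages.continuous_mk R).comp ConfPaths.continuous_single

/-- The sphere carries the subspace topology of `Φ_N^N`: continuous functions on `Φ_N^N` with values
in a Hausdorff space separate its points, and it is compact. -/
lemma isInducing_sphereToLocal : IsInducing (sphereToLocal : SphereSpace N → LocalImages N) := by
  let F : LocalImages N → (Fin N → ℝ) → ℝ≥0∞ := fun φ y => closeness y φ.slice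
  have hF : Continuous F := continuous_pi LocalImages.continuous_closeness
  have hcoe : ∀ x y : Fin N → ℝ, F (sphereToLocal (x : SphereSpace N)) y = 1 - edist x y :=
    fun x y => by simp [F, slice_sphereToLocal_coe, closeness]
  have hinf : ∀ y : Fin N → ℝ, F (sphereToLocal (∞ : SphereSpace N)) y = 0 :=
    fun y => by simp [F, slice_sphereToLocal_infty, closeness]
  have hinj : Function.Injective (F ∘ sphereToLocal) := by
    intro a b h
    induction a using OnePoint.rec with
    | infty =>
      induction b using OnePoint.rec with
      | infty => rfl
      | coe y =>
        have := congrFun h y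
        simp [hcoe, hinf] at this
    | coe x =>
      have := congrFun h x
      induction b using OnePoint.rec with
      | infty => simp [hcoe, hinf] at this
      | coe y =>
        simp only [Function.comp_apply, hcoe, edist_self, tsub_zero] at this
        by_contra hne
        have hxy : edist y x ≠ 0 := fun h0 => hne (by rw [edist_eq_zero.1 h0])
        exact (ENNReal.sub_lt_self ENNReal.one_ne_top one_ne_zero hxy).ne this.symm
  exact IsInducing.of_comp continuous_sphereToLocal hF
    ((hF.comp continuous_sphereToLocal).isClosedEmbedding hinj).isInducing

/-! ### The deformation retraction -/

/-- After zooming in by the crowding of the configuration at time zero, at most one point is left,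
because `shrink b` takes values in the ball of radius `1 / b`. -/
lemma LocalImages.exists_sphereToLocal_eq_zoom (φ : LocalImages N) :
    ∃ x : SphereSpace N, sphereToLocal x = φ.zoom 0 (crowding φ.slice).toNNReal := by
  set b := (crowding φ.slice).toNNReal with hb
  have hb' : (b : ℝ≥0∞) = crowding φ.slice := ENNReal.coe_toNNReal φ.crowding_lt_top.ne
  have hsupp : (φ.zoom 0 b).support = {p | shrink b p.2 ∈ φ.slice} := by
    rw [LocalImages.support_zoom]
    ext p
    simp [LocalImages.slice]
  have hsub : ∀ y z : Fin N → ℝ, shrink b y ∈ φ.slice → shrink b z ∈ φ.slice → y = z := by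
    intro y z hy hz
    by_contra hne
    have hle := le_crowding hy hz ((shrink_injective b).ne hne)
    have hlt : ∀ w : Fin N → ℝ, (b : ℝ≥0∞) * ‖shrink b w‖ₑ < 1 := fun w => by
      rw [enorm_eq_nnnorm]
      exact_mod_cast mul_norm_shrink_lt_one b w
    have h1 : (b : ℝ≥0∞) * max ‖shrink b y‖ₑ ‖shrink b z‖ₑ < 1 := by
      rcases max_choice ‖shrink b y‖ₑ ‖shrink b z‖ₑ with h | h <;> rw [h] <;> exact hlt _
    rw [← hb', ENNReal.inv_le_iff_le_mul] at hle
    · exact hle.not_gt (mul_comm (b : ℝ≥0∞) _ ▸ h1)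
    · exact fun h => absurd h ENNReal.coe_ne_top
    · exact fun h => absurd h (max_lt enorm_lt_top enorm_lt_top).ne
  by_cases h : ∃ y : Fin N → ℝ, shrink b y ∈ φ.slice
  · obtain ⟨y, hy⟩ := h
    refine ⟨(y : SphereSpace N), LocalImages.support_injective ?_⟩
    rw [support_sphereToLocal_coe, hsupp]
    ext p
    refine ⟨fun hp => ?_, fun hp => hsub _ _ hp hy⟩
    rw [Set.mem_ofPred_eq, show p.2 = y from hp]
    exact hy
  · refine ⟨∞, LocalImages.support_injective ?_⟩
    rw [support_sphereToLocal_infty, hsupp]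
    exact (Set.eq_empty_of_forall_notMem fun p hp => h ⟨_, hp⟩).symm

lemma crowding_slice_sphereToLocal (x : SphereSpace N) : crowding (sphereToLocal x).slice = 0 := by
  refine crowding_eq_zero ?_
  induction x using OnePoint.rec with
  | infty => rw [slice_sphereToLocal_infty]; exact Set.subsingleton_empty
  | coe x => rw [slice_sphereToLocal_coe]; exact Set.subsingleton_singleton

lemma zoom_zero_sphereToLocal (c : I) (x : SphereSpace N) :
    (sphereToLocal x).zoom c 0 = sphereToLocal x := by
  refine LocalImages.support_injective ?_
  rw [LocalImages.support_zoom]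
  induction x using OnePoint.rec with
  | infty => rw [support_sphereToLocal_infty]; rfl
  | coe x => simp [support_sphereToLocal_coe, shrink_zero]

lemma LocalImages.zoom_one_zero (φ : LocalImages N) : φ.zoom 1 0 = φ := by
  refine LocalImages.support_injective ?_
  rw [LocalImages.support_zoom]
  simp [shrink_zero]

/-- The retraction `Φ_N^N → S^N`: the point that is left after zooming in, or `∞` if there is
none. -/
noncomputable def localToSphere (φ : LocalImages N) : SphereSpace N :=
  φ.exists_sphereToLocal_eq_zoom.choose

lemma sphereToLocal_localToSphere (φ : LocalImages N) :
    sphereToLocal (localToSphere φ) = φ.zoom 0 (crowding φ.slice).toNNReal :=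
  φ.exists_sphereToLocal_eq_zoom.choose_spec

lemma continuous_localToSphere : Continuous (localToSphere : LocalImages N → SphereSpace N) := by
  rw [isInducing_sphereToLocal.continuous_iff]
  have : sphereToLocal ∘ localToSphere = fun φ : LocalImages N =>
      φ.zoom 0 (crowding φ.slice).toNNReal := funext sphereToLocal_localToSphere
  rw [this]
  exact LocalImages.continuous_zoom.comp (continuous_id.prodMk
    (continuous_const.prodMk LocalImages.continuous_crowding))

lemma localToSphere_sphereToLocal (x : SphereSpace N) : localToSphere (sphereToLocal x) = x := by
  -- an inducing map from a Hausdorff space is injective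
  refine isInducing_sphereToLocal.injective ?_
  rw [sphereToLocal_localToSphere, crowding_slice_sphereToLocal, ENNReal.toNNReal_zero,
    zoom_zero_sphereToLocal]

/-- While time is slowed down to a halt, the configuration is magnified until only one point is
left. -/
noncomputable def localHomotopy :
    ContinuousMap.HomotopyRel (ContinuousMap.id (LocalImages N))
      ((ContinuousMap.mk sphereToLocal continuous_sphereToLocal).comp
        (ContinuousMap.mk localToSphere continuous_localToSphere))
      (Set.range (sphereToLocal : SphereSpace N → LocalImages N)) where
  toFun q := q.2.zoom (unitInterval.symm q.1)
    (q.1.1.toNNReal * (crowding q.2.slice).toNNReal)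
  continuous_toFun := LocalImages.continuous_zoom.comp (continuous_snd.prodMk
    ((unitInterval.continuous_symm.comp continuous_fst).prodMk
      ((continuous_real_toNNReal.comp (continuous_subtype_val.comp continuous_fst)).mul
        (LocalImages.continuous_crowding.comp continuous_snd))))
  map_zero_left φ := by simp [LocalImages.zoom_one_zero]
  map_one_left φ := by simp [sphereToLocal_localToSphere]
  prop' t φ hφ := by
    obtain ⟨x, rfl⟩ := hφ
    simp [crowding_slice_sphereToLocal, zoom_zero_sphereToLocal]

lemma isWeakHomotopyEquiv_sphereToLocal :
    IsWeakHomotopyEquiv (ContinuousMap.mk (sphereToLocal : SphereSpace N → LocalImages N)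
      continuous_sphereToLocal) :=
  isWeakHomotopyEquiv_of_homotopicRel _ ⟨localToSphere, continuous_localToSphere⟩
    localToSphere_sphereToLocal ⟨localHomotopy⟩

lemma sphereToLocal_sphereSmash (x : SphereSpace N) (t : OnePoint ℝ) :
    sphereToLocal (sphereSmash x t) = (sphereToLocal x).loop t := by
  have h : ∀ s : ℝ, LocalImages.atHeight s (LocalImages.empty N) = LocalImages.empty (N + 1) := by
    intro s
    refine Subtype.ext (funext fun R => WindowImages.trace_injective ?_)
    change (ConfPaths.atHeight s (ConfPaths.empty N)).image ∩ _ =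
      (ConfPaths.empty (N + 1)).image ∩ _
    rw [ConfPaths.image_atHeight, ConfPaths.image_empty, ConfPaths.image_empty, Set.image_empty]
  induction x using OnePoint.rec with
  | infty =>
    induction t using OnePoint.rec with
    | infty => rfl
    | coe s => exact (h s).symm
  | coe x => induction t using OnePoint.rec <;> rfl

end Sphere

/-! ### The structure maps and the equivalence -/

/-- The structure map `Φ_N^N → Ω Φ_{N+1}^{N+1}`, `φ ↦ φ.loop`. -/
def loopMap (N : ℕ) :
    C(LocalImages N, BasedLoops (LocalImages (N + 1)) (LocalImages.empty (N + 1))) where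
  toFun φ := ⟨(ContinuousMap.mk _ LocalImages.continuous_loop).curry φ, rfl⟩
  continuous_toFun := Continuous.subtype_mk
    ((ContinuousMap.mk _ LocalImages.continuous_loop).curry).continuous fun _ => rfl

lemma loopMap_empty (N : ℕ) (t : OnePoint ℝ) :
    (loopMap N (LocalImages.empty N)).1 t = LocalImages.empty (N + 1) :=
  (sphereToLocal_sphereSmash (∞ : SphereSpace N) t).symm

theorem mainTheorem6 :
    ∃ (ω : ∀ N : ℕ, C(LocalImages N, BasedLoops (LocalImages (N + 1)) (LocalImages.empty (N + 1))))
      (hω : ∀ (N : ℕ) (t : OnePoint ℝ),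
        (ω N (LocalImages.empty N)).1 t = LocalImages.empty (N + 1)),
      (∀ (N : ℕ) (φ : LocalImages N) (t : OnePoint ℝ), (ω N φ).1 t = φ.loop t) ∧
      ∃ (Φ' : Spectrum)
        (f : SpectrumMap Φ'
          { space := LocalImages, point := LocalImages.empty, struct := ω, struct_point := hω })
        (g : SpectrumMap Φ' sphereSpectrum),
        f.IsLevelwiseWeakEquiv ∧ g.IsLevelwiseWeakEquiv := by
  refine ⟨loopMap, loopMap_empty, fun N φ t => rfl, sphereSpectrum,
    { map := fun N => ⟨sphereToLocal, continuous_sphereToLocal⟩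
      map_point := fun _ => rfl
      map_struct := fun N => sphereToLocal_sphereSmash },
    { map := fun N => ContinuousMap.id _
      map_point := fun _ => rfl
      map_struct := fun _ _ _ => rfl },
    fun N => isWeakHomotopyEquiv_sphereToLocal, fun N => ?_⟩
  exact isWeakHomotopyEquiv_of_homotopicRel _ (ContinuousMap.id _) (fun _ => rfl)
    (ContinuousMap.HomotopicRel.refl _)
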